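/- Let $\mathbb{B}=\{\mathsf{T},\mathsf{F}\}$. **Instruction sequences.** Let $\mathcal{F}$ be a set of foci that contains the pairwise different foci $\mathsf{in}{:}i$ and $\mathsf{aux}{:}i$ ($i\ge 1$) and $\mathsf{out}$, and let $\mathcal{M}$ be a set of methods that contains $\mathsf{set{:}T}$, $\mathsf{set{:}F}$ and $\mathsf{get}$; basic instructions are the $f.m$ with $f\in\mathcal{F}$, $m\in\mathcal{M}$. The primitive instructions are, for each basic instruction $a$, the plain basic instruction $a$, the positive test $+a$ and the negative test $-a$; for each $l\in\mathbb{N}$, the forward jump $\#l$; and the termination instruction $!$. Let $\mathcal{IS}_{\mathrm{br}}$ be the set of all non-empty finite sequences of primitive instructions in which every plain or test instruction contains a basic instruction of one of the forms $\mathsf{in}{:}i.\mathsf{get}$, $\mathsf{aux}{:}i.\mathsf{get}$, $\mathsf{aux}{:}i.\mathsf{set}{:}b$, $\mathsf{out}.\mathsf{set}{:}b$ ($i\geq 1$, $b\in\mathbb{B}$). A focus names a Boolean register; $\mathsf{set}{:}b$ makes its contents $b$ and replies $b$, and $\mathsf{get}$ replies its contents and changes nothing. Execution starts with the first instruction. After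 $a$ it proceeds with the next instruction; after $+a$ it proceeds with the next instruction if the reply is $\mathsf{T}$ and skips the next instruction if the reply is $\mathsf{F}$; for $-a$ the roles of the replies are reversed; $\#l$ proceeds with the $l$-th next instruction; $!$ terminates. If $l=0$, if there is no instruction to proceed with, or if a register is addressed that is not provided, execution ends without termination and yields no result. An $X\in\mathcal{IS}_{\mathrm{br}}$ *computes* $f:\mathbb{B}^n\to\mathbb{B}$ if there is an $l\in\mathbb{N}$ such that, for all $b_1,\dots,b_n\in\mathbb{B}$, the execution of $X$ with registers $\mathsf{aux}{:}1,\dots,\mathsf{aux}{:}l$ and $\mathsf{out}$ initially containing $\mathsf{F}$ and registers $\mathsf{in}{:}1,\dots,\mathsf{in}{:}n$ initially containing $b_1,\dots,b_n$ terminates with $f(b_1,\dots,b_n)$ in $\mathsf{out}$. A *Boolean function family* is a sequence $(f_n)_{n\in\mathbb{N}}$ with $f_n:\mathbb{B}^n\to\mathbb{B}$, and $\mathrm{PLIS}$ is the class of all Boolean function families $(f_n)_{n\in\mathbb{N}}$ for which there is a polynomial function $h:\mathbb{N}\to\mathbb{N}$ such that for every $n\in\mathbb{N}$ some $X\in\mathcal{IS}_{\mathrm{br}}$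 of length at most $h(n)$ computes $f_n$. **P/poly.** A Boolean circuit with $n$ inputs is a finite directed acyclic graph with exactly $n$ sources, the input vertices, and exactly one sink, the output vertex, whose other vertices than the sources are $\lnot$-gates of fan-in $1$ or $\lor$-gates or $\land$-gates of fan-in $2$; its size is its number of vertices. $\mathrm{P/poly}$ is the class of all functions $f:\mathbb{B}^*\to\mathbb{B}$ for which there is a polynomial function $T:\mathbb{N}\to\mathbb{N}$ such that for every $n\ge 1$ some circuit with $n$ inputs and size at most $T(n)$ computes the restriction of $f$ to $\mathbb{B}^n$. **Theorem.** Identify each Boolean function family $(f_n)_{n\in\mathbb{N}}$ with the unique function $f:\mathbb{B}^*\to\mathbb{B}$ such that $f(w)=f_n(w)$ for all $n\in\mathbb{N}$ and $w\in\mathbb{B}^n$. Then $$\mathrm{PLIS}=\mathrm{P/poly}.$$ -/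

import Mathlib

namespace SinglePass

/-! ### Boolean function families -/

/-- A Boolean function family: an `n`-ary Boolean function for each `n`. -/
abbrev BoolFunFamily : Type := ∀ n : ℕ, (Fin n → Bool) → Bool

/-- The identification of Boolean function families with functions from the finite strings over
the Booleans to the Booleans: the family `f` corresponds to the function whose restriction to the
strings of length `n` is `f n`. -/
def familyEquiv : BoolFunFamily ≃ (List Bool → Bool) where
  toFun f w := f w.length w.get
  invFun g n b := g (List.ofFn b)
  left_inv f := by
    funext n b
    have key : ∀ (m : ℕ) (h : m = n) (c : Fin m → Bool), (∀ i, c i = b (Fin.cast h i)) →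
        f m c = f n b := by
      intro m h c hc
      subst h
      exact congrArg (f m) (funext hc)
    exact key _ (List.length_ofFn) _ (fun i => by simp [Fin.cast])
  right_inv g := by
    funext w
    exact congrArg g (List.ofFn_get w)

/-- The functions from `ℕ` to `ℕ` that are polynomial. -/
def poly : Set (ℕ → ℕ) := {h | ∃ p : Polynomial ℝ, ∀ n : ℕ, (h n : ℝ) = p.eval (n : ℝ)}

/-! ### Foci, methods, services -/

/-- Foci. `inp i` and `aux i` are the names of the `(i+1)`-th input register and the `(i+1)`-th
auxiliary register (the indices start at `0` here), `out` is the name of the output register, and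
there may be arbitrary further foci. -/
inductive Focus (Φ : Type*) where
  | inp (i : ℕ)
  | aux (i : ℕ)
  | out
  | other (x : Φ)

/-- Methods: the three methods of Boolean registers and arbitrary further methods. -/
inductive Meth (M : Type*) where
  | set (b : Bool)
  | get
  | other (m : M)

/-- Replies: true, false, blocked. -/
inductive Reply where
  | val (b : Bool)
  | blocked

/-- Services: the empty service, and Boolean registers with their contents. -/
inductive Service where
  | empty
  | br (b : Bool)

/-- The service that results from processing a method. -/
def Service.derive {M : Type*} (m : Meth M) : Service → Service
  | .empty => .empty
  | .br b =>
    match m with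
    | .set c => .br c
    | .get => .br b
    | .other _ => .empty

/-- The reply that is produced on processing a method. -/
def Service.reply {M : Type*} (m : Meth M) : Service → Reply
  | .empty => .blocked
  | .br b =>
    match m with
    | .set c => .val c
    | .get => .val b
    | .other _ => .blocked

/-- Basic instructions (which are also the basic actions): the basic instruction `f.m` requests
the service named `f` to process the method `m`. -/
structure BasicInstr (Φ M : Type*) where
  focus : Focus Φ
  meth : Meth M

/-! ### Instruction sequences and threads -/

/-- Primitive instructions. -/
inductive Instr (Φ M : Type*) where
  | plain (a : BasicInstr Φ M)
  | ptest (a : BasicInstr Φ M)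
  | ntest (a : BasicInstr Φ M)
  | jump (l : ℕ)
  | halt

/-- Finite threads. Since `x ⊴ tau ⊵ y` and `x ⊴ tau ⊵ x` are identified, the internal action
`tau` has only one continuation. -/
inductive Thread (Φ M : Type*) where
  /-- inaction -/
  | deadEnd
  /-- termination -/
  | terminated
  /-- internal action -/
  | tau (x : Thread Φ M)
  /-- `pcc x a y` performs `a`, and proceeds as `x` on reply true and as `y` on reply false -/
  | pcc (x : Thread Φ M) (a : BasicInstr Φ M) (y : Thread Φ M)

/-- Thread extraction: the behaviour produced by a finite instruction sequence on execution. -/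
def extr {Φ M : Type*} : List (Instr Φ M) → Thread Φ M
  | [] => .deadEnd
  | .plain a :: X => .pcc (extr X) a (extr X)
  | .ptest a :: X => .pcc (extr X) a (extr (.jump 2 :: X))
  | .ntest a :: X => .pcc (extr (.jump 2 :: X)) a (extr X)
  | .jump 0 :: _ => .deadEnd
  | .jump 1 :: X => extr X
  | .jump (_ + 2) :: [] => .deadEnd
  | .jump (l + 2) :: _ :: X => extr (.jump (l + 1) :: X)
  | .halt :: _ => .terminated
termination_by X => 2 * X.length + (match X with | .jump _ :: _ => 0 | _ => 1)
decreasing_by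
  all_goals simp_wf
  all_goals (try split) <;> omega

open Classical in
/-- The use operator: `use f p S` is the thread that results from processing the method of each
basic action with focus `f` that the thread `p` performs by the service `S`. -/
noncomputable def use {Φ M : Type*} (f : Focus Φ) : Thread Φ M → Service → Thread Φ M
  | .terminated, _ => .terminated
  | .deadEnd, _ => .deadEnd
  | .tau x, S => .tau (use f x S)
  | .pcc x a y, S =>
    if a.focus = f then
      match S.reply a.meth with
      | .val true => .tau (use f x (S.derive a.meth))
      | .val false => .tau (use f y (S.derive a.meth))
      | .blocked => .tau .deadEnd
    else .pcc (use f x S) a (use f y S)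

open Classical in
/-- The apply operator: `apply f p S` is the service that results from processing the method of
each basic action with focus `f` that the thread `p` performs by the service `S`. -/
noncomputable def apply {Φ M : Type*} (f : Focus Φ) : Thread Φ M → Service → Service
  | .terminated, S => S
  | .deadEnd, _ => .empty
  | .tau x, S => apply f x S
  | .pcc x a y, S =>
    if a.focus = f then
      match S.reply a.meth with
      | .val true => apply f x (S.derive a.meth)
      | .val false => apply f y (S.derive a.meth)
      | .blocked => .empty
    else .empty

/-! ### Instruction sequences acting on Boolean registers -/

/-- The basic instructions that may occur in instruction sequences acting on Boolean registers:
input registers can be read, auxiliary registers can be read and set, the output register can be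
set. -/
def BasicInstr.IsBr {Φ M : Type*} (a : BasicInstr Φ M) : Prop :=
  (a.meth = .get ∧ ∃ i, a.focus = .inp i ∨ a.focus = .aux i) ∨
  ((∃ b, a.meth = .set b) ∧ ((∃ i, a.focus = .aux i) ∨ a.focus = .out))

/-- The primitive instructions that may occur in instruction sequences acting on Boolean
registers. -/
def Instr.IsBr {Φ M : Type*} : Instr Φ M → Prop
  | .plain a => a.IsBr
  | .ptest a => a.IsBr
  | .ntest a => a.IsBr
  | .jump _ => True
  | .halt => True

/-- The (non-empty, finite) instruction sequences acting on Boolean registers. -/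
def ISbr (Φ M : Type*) : Set (List (Instr Φ M)) := {X | X ≠ [] ∧ ∀ u ∈ X, u.IsBr}

/-- The thread `p` using the first `l` auxiliary registers, each initially containing false. -/
noncomputable def useAux {Φ M : Type*} (p : Thread Φ M) (l : ℕ) : Thread Φ M :=
  (List.range l).foldl (fun q j => use (.aux j) q (.br false)) p

/-- The thread `p` using the first `n` input registers, with initial contents `b`. -/
noncomputable def useInp {Φ M : Type*} (p : Thread Φ M) {n : ℕ} (b : Fin n → Bool) :
    Thread Φ M :=
  (List.finRange n).foldl (fun q (i : Fin n) => use (.inp (i : ℕ)) q (.br (b i))) p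

/-- The instruction sequence `X` computes the `n`-ary Boolean function `f`. -/
def Computes {Φ M : Type*} (X : List (Instr Φ M)) {n : ℕ} (f : (Fin n → Bool) → Bool) : Prop :=
  ∃ l : ℕ, ∀ b : Fin n → Bool,
    apply .out (useInp (useAux (extr X) l) b) (.br false) = .br (f b)

/-- The class of all Boolean function families that can be computed by instruction sequences from
`IS` whose length is bounded by a function from `FN`. -/
def nuc {Φ M : Type*} (IS : Set (List (Instr Φ M))) (FN : Set (ℕ → ℕ)) : Set BoolFunFamily :=
  {f | ∃ h ∈ FN, ∀ n : ℕ, ∃ X ∈ IS, Computes X (f n) ∧ X.length ≤ h n}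

/-- The class of all Boolean function families that can be computed by polynomial-length
instruction sequences acting on Boolean registers. -/
def PLIS (Φ M : Type*) : Set BoolFunFamily := nuc (ISbr Φ M) poly

/-! ### Boolean circuits and P/poly -/

/-- The label of a vertex of a Boolean circuit with `n` inputs, together with the tails of the
edges that enter the vertex. -/
inductive CNode (n : ℕ) (V : Type) where
  | input (i : Fin n)
  | not (u : V)
  | or (u v : V)
  | and (u v : V)

/-- There is an edge from `w` to a vertex with the given label. -/
def CNode.HasPred {n : ℕ} {V : Type} : CNode n V → V → Prop
  | .input _, _ => False
  | .not u, w => w = u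
  | .or u v, w => w = u ∨ w = v
  | .and u v, w => w = u ∨ w = v

/-- Boolean circuits with `n` inputs and a single output: finite directed acyclic graphs with
exactly `n` sources, the input vertices, and exactly one sink, the output vertex, in which all
other vertices than sources are negation gates with fan-in 1 or disjunction gates or conjunction
gates with fan-in 2. -/
structure BoolCircuit (n : ℕ) where
  /-- the number of vertices -/
  size : ℕ
  node : Fin size → CNode n (Fin size)
  acyclic : ∀ v, ¬ Relation.TransGen (fun u w => (node w).HasPred u) v v
  exists_unique_input : ∀ i : Fin n, ∃! v, node v = .input i
  out : Fin size
  sink_iff : ∀ v, (∀ w, ¬ (node w).HasPred v) ↔ v = out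

theorem BoolCircuit.wellFounded {n : ℕ} (C : BoolCircuit n) :
    WellFounded (fun u w => (C.node w).HasPred u) := by
  have : Std.Irrefl (Relation.TransGen fun u w => (C.node w).HasPred u) := ⟨C.acyclic⟩
  have hwf := Finite.wellFounded_of_trans_of_irrefl
    (Relation.TransGen fun u w => (C.node w).HasPred u)
  have hsub : Subrelation (fun u w => (C.node w).HasPred u)
      (Relation.TransGen fun u w => (C.node w).HasPred u) := fun {_ _} h => .single h
  exact hsub.wf hwf

/-- The value of a labelled vertex in terms of the values of its direct predecessors. -/
def CNode.eval {n : ℕ} {V : Type} (b : Fin n → Bool) :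
    (c : CNode n V) → ((u : V) → c.HasPred u → Bool) → Bool
  | .input i, _ => b i
  | .not u, r => !(r u rfl)
  | .or u v, r => r u (Or.inl rfl) || r v (Or.inr rfl)
  | .and u v, r => r u (Or.inl rfl) && r v (Or.inr rfl)

/-- The value of a vertex of a circuit on input `b`. -/
noncomputable def BoolCircuit.val {n : ℕ} (C : BoolCircuit n) (b : Fin n → Bool) :
    Fin C.size → Bool :=
  C.wellFounded.fix (fun v r => (C.node v).eval b r)

theorem BoolCircuit.val_eq {n : ℕ} (C : BoolCircuit n) (b : Fin n → Bool) (v : Fin C.size) :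
    C.val b v = (C.node v).eval b (fun u _ => C.val b u) :=
  C.wellFounded.fix_eq _ v

/-- The output of a circuit on input `b`. -/
noncomputable def BoolCircuit.output {n : ℕ} (C : BoolCircuit n) (b : Fin n → Bool) : Bool :=
  C.val b C.out

/-- The functions on strings that are computed by a circuit family whose `n`-th circuit has at
most `T n` vertices. A finite acyclic graph with a sink has a source, so there is no circuit with
`0` inputs, and circuit families are indexed by the positive natural numbers. -/
def SIZE (T : ℕ → ℕ) : Set (List Bool → Bool) :=
  {f | ∀ n : ℕ, 1 ≤ n → ∃ C : BoolCircuit n, C.size ≤ T n ∧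
    ∀ b : Fin n → Bool, C.output b = f (List.ofFn b)}

/-- The class P/poly: the functions on strings (characteristic functions of languages) that are
computed by circuit families of polynomial size. -/
def PPoly : Set (List Bool → Bool) := {f | ∃ T ∈ poly, f ∈ SIZE T}

end SinglePass

namespace SinglePass

/-! ### Running a thread in an environment of services -/

/-! Both inclusions are simulations with linear overhead, once the operators `use` and `apply` are
replaced by a run `runT` of the thread in an environment of services (`apply_out_useInp_useAux`).

From circuits to instruction sequences, every vertex gets an auxiliary register. The vertices are
evaluated in topological order by at most four instructions each
(`BoolCircuit.exists_closed_finset`), and three more copy the result to `out`. There is no circuit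
without inputs, so `n = 0` is treated apart.

Conversely, all jumps go forward, so one pass from left to right simulates an execution; its state
is the number of instructions still to be skipped and the register contents (`passAll_out`). For
each skip count `q`, "exactly `q` are to be skipped" is a Boolean function of the input, and so is
each register. Passing an instruction mostly renumbers these functions and costs at most 11 gates
(`Generates.pass`). This gives a straight-line circuit with `n + 3 + 11 k` vertices for length `k`;
making its sink unique triples that at most (`Generates.exists_circuit`). -/

open Classical in
/-- The final contents of the output register when the thread runs with the services `ρ`. -/
noncomputable def runT {Φ M : Type*} : Thread Φ M → (Focus Φ → Service) → Service
  | .terminated, ρ => ρ .out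
  | .deadEnd, _ => .empty
  | .tau x, ρ => runT x ρ
  | .pcc x a y, ρ =>
    match (ρ a.focus).reply a.meth with
    | .val true => runT x (Function.update ρ a.focus ((ρ a.focus).derive a.meth))
    | .val false => runT y (Function.update ρ a.focus ((ρ a.focus).derive a.meth))
    | .blocked => .empty

-- `apply` gives the empty service when an action on another focus remains; this matches a run in
-- which every other service is empty and therefore blocks.
open Classical in
theorem apply_out_eq_runT {Φ M : Type*} (p : Thread Φ M) (S : Service) :
    apply .out p S = runT p (Function.update (fun _ => .empty) .out S) := by
  induction p generalizing S with
  | deadEnd => rfl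
  | terminated => simp [apply, runT]
  | tau x ih => simp [apply, runT, ih]
  | pcc x a y ihx ihy =>
    by_cases h : a.focus = .out
    · simp only [apply, runT, h, if_true, Function.update_self, Function.update_idem, ihx, ihy]
    · simp [apply, runT, h, Service.reply]

-- `use` resolves the actions on `f` in advance and leaves the others alone, so its service may as
-- well sit in the environment. The result is read at `out`, which must therefore differ from `f`.
open Classical in
theorem runT_use {Φ M : Type*} {f : Focus Φ} (hf : f ≠ .out) (p : Thread Φ M) (S : Service)
    (ρ : Focus Φ → Service) : runT (use f p S) ρ = runT p (Function.update ρ f S) := by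
  induction p generalizing S ρ with
  | deadEnd => rfl
  | terminated => simp [use, runT, Function.update_of_ne hf.symm]
  | tau x ih => simp [use, runT, ih]
  | pcc x a y ihx ihy =>
    by_cases h : a.focus = f
    · simp only [use, runT, h, if_true, Function.update_self, Function.update_idem]
      cases hr : S.reply a.meth with
      | blocked => simp [runT]
      | val b => cases b <;> simp [runT, ihx, ihy]
    · simp only [use, runT, h, if_false, Function.update_of_ne h, ihx, ihy]
      rw [Function.update_comm h]

open Classical in
theorem runT_foldl_use {Φ M α : Type*} (φ : α → Focus Φ) (hφ : ∀ i, φ i ≠ .out)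
    (s : α → Service) (L : List α) (p : Thread Φ M) (ρ : Focus Φ → Service) :
    runT (L.foldl (fun q i => use (φ i) q (s i)) p) ρ =
      runT p (L.foldr (fun i e => Function.update e (φ i) (s i)) ρ) := by
  induction L generalizing p with
  | nil => rfl
  | cons i L ih => simp only [List.foldl_cons, List.foldr_cons, ih, runT_use (hφ i)]

open Classical in
theorem foldr_update_apply {α β γ : Type*} (φ : α → β) (hφ : Function.Injective φ) (s : α → γ)
    (L : List α) (ρ : β → γ) {i : α} (hi : i ∈ L) :
    L.foldr (fun i e => Function.update e (φ i) (s i)) ρ (φ i) = s i := by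
  induction L with
  | nil => simp at hi
  | cons j L ih =>
    by_cases h : i = j
    · simp [h]
    · have : φ i ≠ φ j := fun e => h (hφ e)
      rw [List.foldr_cons, Function.update_of_ne this, ih (by simpa [h] using hi)]

open Classical in
theorem foldr_update_apply_of_forall_ne {α β γ : Type*} (φ : α → β) (s : α → γ)
    (L : List α) (ρ : β → γ) {x : β} (hx : ∀ i ∈ L, x ≠ φ i) :
    L.foldr (fun i e => Function.update e (φ i) (s i)) ρ x = ρ x := by
  induction L with
  | nil => rfl
  | cons j L ih =>
    rw [List.foldr_cons, Function.update_of_ne (hx j (by simp)),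
      ih fun i hi => hx i (by simp [hi])]

/-- The services provided to an instruction sequence: `l` auxiliary registers with contents `σ`,
input registers with contents `b`, and the output register with contents `o`. -/
def regEnv {Φ : Type*} {n : ℕ} (l : ℕ) (b : Fin n → Bool) (σ : ℕ → Bool) (o : Bool) :
    Focus Φ → Service
  | .inp i => if h : i < n then .br (b ⟨i, h⟩) else .empty
  | .aux j => if j < l then .br (σ j) else .empty
  | .out => .br o
  | .other _ => .empty

theorem apply_out_useInp_useAux {Φ M : Type*} (p : Thread Φ M) {n : ℕ} (l : ℕ)
    (b : Fin n → Bool) :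
    apply .out (useInp (useAux p l) b) (.br false) =
      runT p (regEnv l b (fun _ => false) false) := by
  classical
  have haux : Function.Injective (Focus.aux (Φ := Φ)) := fun _ _ h => by cases h; rfl
  have hinp : Function.Injective (fun i : Fin n => Focus.inp (Φ := Φ) i) :=
    fun i j h => Fin.ext (by injection h)
  rw [apply_out_eq_runT, useInp, runT_foldl_use _ (by simp), useAux, runT_foldl_use _ (by simp)]
  congr 1
  funext x
  cases x with
  | inp i =>
    rw [foldr_update_apply_of_forall_ne _ _ _ _ (by simp)]
    by_cases h : i < n
    · have := foldr_update_apply (fun i : Fin n => Focus.inp (Φ := Φ) i) hinp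
        (fun i => Service.br (b i)) (List.finRange n)
        (Function.update (fun _ => .empty) .out (.br false)) (List.mem_finRange ⟨i, h⟩)
      simpa [regEnv, h] using this
    · rw [foldr_update_apply_of_forall_ne]
      · simp [regEnv, h]
      · rintro j - e
        cases e
        exact h j.2
  | aux j =>
    by_cases h : j < l
    · rw [foldr_update_apply _ haux _ _ _ (List.mem_range.2 h)]
      simp [regEnv, h]
    · rw [foldr_update_apply_of_forall_ne, foldr_update_apply_of_forall_ne _ _ _ _ (by simp)]
      · simp [regEnv, h]
      · rintro i hi e
        cases e
        exact h (List.mem_range.1 hi)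
  | out =>
    rw [foldr_update_apply_of_forall_ne _ _ _ _ (by simp),
      foldr_update_apply_of_forall_ne _ _ _ _ (by simp)]
    simp [regEnv]
  | other y =>
    rw [foldr_update_apply_of_forall_ne _ _ _ _ (by simp),
      foldr_update_apply_of_forall_ne _ _ _ _ (by simp)]
    simp [regEnv]

theorem computes_iff {Φ M : Type*} {X : List (Instr Φ M)} {n : ℕ} {f : (Fin n → Bool) → Bool} :
    Computes X f ↔
      ∃ l : ℕ, ∀ b, runT (extr X) (regEnv l b (fun _ => false) false) = .br (f b) := by
  simp only [Computes, apply_out_useInp_useAux]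

theorem extr_jump_succ {Φ M : Type*} (l : ℕ) (X : List (Instr Φ M)) :
    extr (.jump (l + 1) :: X) = extr (X.drop l) := by
  induction l generalizing X with
  | zero => simp [extr]
  | succ l ih =>
    cases X with
    | nil => simp [extr]
    | cons u X => rw [extr, ih, List.drop_succ_cons]

/-! ### From circuits to instruction sequences -/

section Fragments

variable {Φ M : Type*} {n l : ℕ} {b : Fin n → Bool} {σ : ℕ → Bool} {o : Bool}

open Classical in
theorem regEnv_update_self (x : Focus Φ) :
    Function.update (regEnv l b σ o) x (regEnv l b σ o x) = regEnv l b σ o :=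
  Function.update_eq_self _ _

open Classical in
theorem regEnv_update_aux {v : ℕ} (hv : v < l) (c : Bool) :
    Function.update (regEnv (Φ := Φ) l b σ o) (.aux v) (.br c) =
      regEnv l b (Function.update σ v c) o := by
  funext x
  by_cases hx : x = .aux v
  · subst hx
    simp [regEnv, hv]
  · rw [Function.update_of_ne hx]
    cases x with
    | aux j =>
      have : j ≠ v := fun e => hx (by rw [e])
      simp [regEnv, this]
    | _ => rfl

open Classical in
theorem regEnv_update_out (c : Bool) :
    Function.update (regEnv (Φ := Φ) l b σ o) .out (.br c) = regEnv l b σ c := by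
  funext x
  by_cases hx : x = .out
  · subst hx
    simp [regEnv]
  · rw [Function.update_of_ne hx]
    cases x with
    | out => exact absurd rfl hx
    | _ => rfl

theorem runT_set_aux {v : ℕ} (hv : v < l) (c : Bool) (X : List (Instr Φ M)) :
    runT (extr (.plain ⟨.aux v, .set c⟩ :: X)) (regEnv l b σ o) =
      runT (extr X) (regEnv l b (Function.update σ v c) o) := by
  rw [extr, runT]
  have h : regEnv (Φ := Φ) l b σ o (.aux v) = .br (σ v) := by simp [regEnv, hv]
  cases c <;> simp [h, Service.reply, Service.derive, regEnv_update_aux hv]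

theorem runT_set_out (c : Bool) (X : List (Instr Φ M)) :
    runT (extr (.plain ⟨.out, .set c⟩ :: X)) (regEnv l b σ o) =
      runT (extr X) (regEnv l b σ c) := by
  rw [extr, runT]
  have h : regEnv (Φ := Φ) l b σ o .out = .br o := rfl
  cases c <;> simp [h, Service.reply, Service.derive, regEnv_update_out]

theorem runT_ptest_get {x : Focus Φ} {c : Bool} (h : regEnv l b σ o x = .br c)
    (X : List (Instr Φ M)) :
    runT (extr (.ptest ⟨x, .get⟩ :: X)) (regEnv l b σ o) =
      runT (extr (if c then X else X.drop 1)) (regEnv l b σ o) := by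
  have h' := regEnv_update_self (l := l) (b := b) (σ := σ) (o := o) x
  rw [h] at h'
  rw [extr, runT, extr_jump_succ]
  cases c <;> simp [h, Service.reply, Service.derive, h']

theorem runT_ntest_get {x : Focus Φ} {c : Bool} (h : regEnv l b σ o x = .br c)
    (X : List (Instr Φ M)) :
    runT (extr (.ntest ⟨x, .get⟩ :: X)) (regEnv l b σ o) =
      runT (extr (if c then X.drop 1 else X)) (regEnv l b σ o) := by
  have h' := regEnv_update_self (l := l) (b := b) (σ := σ) (o := o) x
  rw [h] at h'
  rw [extr, runT, extr_jump_succ]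
  cases c <;> simp [h, Service.reply, Service.derive, h']

end Fragments

/-- Instructions that store the value of a vertex with the given label in the auxiliary register
`v`, provided that it contains false. -/
def CNode.instrs (Φ M : Type*) {n s : ℕ} (v : ℕ) : CNode n (Fin s) → List (Instr Φ M)
  | .input i => [.ptest ⟨.inp i, .get⟩, .plain ⟨.aux v, .set true⟩]
  | .not u => [.ntest ⟨.aux u, .get⟩, .plain ⟨.aux v, .set true⟩]
  | .or u w => [.ptest ⟨.aux u, .get⟩, .plain ⟨.aux v, .set true⟩,
      .ptest ⟨.aux w, .get⟩, .plain ⟨.aux v, .set true⟩]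
  -- If `u` holds F, the jump leaves the block and register `v` keeps F; if `u` holds T, the jump is
  -- skipped and `w` is tested.
  | .and u w => [.ntest ⟨.aux u, .get⟩, .jump 3,
      .ptest ⟨.aux w, .get⟩, .plain ⟨.aux v, .set true⟩]

theorem CNode.isBr_of_mem_instrs {Φ M : Type*} {n s : ℕ} {v : ℕ} {c : CNode n (Fin s)} :
    ∀ u ∈ c.instrs Φ M v, u.IsBr := by
  cases c <;> simp [CNode.instrs, Instr.IsBr, BasicInstr.IsBr]

theorem CNode.length_instrs_le {Φ M : Type*} {n s : ℕ} (v : ℕ) (c : CNode n (Fin s)) :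
    (c.instrs Φ M v).length ≤ 4 := by
  cases c <;> simp [CNode.instrs]

theorem CNode.runT_instrs {Φ M : Type*} {n s : ℕ} {b : Fin n → Bool} {σ : ℕ → Bool} {o : Bool}
    {v : Fin s} (c : CNode n (Fin s)) (hσ : σ v = false) (hc : ∀ u, c.HasPred u → u ≠ v)
    (X : List (Instr Φ M)) :
    runT (extr (c.instrs Φ M v ++ X)) (regEnv s b σ o) =
      runT (extr X) (regEnv s b (Function.update σ v (c.eval b fun u _ => σ u)) o) := by
  have haux (τ : ℕ → Bool) (u : Fin s) : regEnv (Φ := Φ) s b τ o (.aux u) = .br (τ u) := by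
    simp [regEnv]
  have hinp (i : Fin n) : regEnv (Φ := Φ) s b σ o (.inp i) = .br (b i) := by
    simp [regEnv]
  -- For the value F nothing is written, which agrees with writing F because the register already
  -- contains it.
  have hid : Function.update σ v false = σ := by rw [← hσ, Function.update_eq_self]
  cases c with
  | input i =>
    rw [CNode.instrs, List.cons_append, runT_ptest_get (hinp i)]
    cases h : b i <;> simp [runT_set_aux, CNode.eval, h, hid]
  | not u =>
    rw [CNode.instrs, List.cons_append, runT_ntest_get (haux σ u)]
    cases h : σ u <;> simp [runT_set_aux, CNode.eval, h, hid]
  | or u w =>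
    -- The block may set `v` before it reads `w`.
    have hw : (w : ℕ) ≠ v := fun e => hc w (Or.inr rfl) (Fin.ext e)
    rw [CNode.instrs, List.cons_append, runT_ptest_get (haux σ u)]
    cases h : σ u <;> cases h' : σ w <;>
      simp [runT_set_aux, runT_ptest_get (haux _ w), CNode.eval, h, h', hid, hw]
  | and u w =>
    rw [CNode.instrs, List.cons_append, runT_ntest_get (haux σ u)]
    cases h : σ u <;> cases h' : σ w <;>
      simp [runT_set_aux, runT_ptest_get (haux _ w), CNode.eval, h, h', hid, extr_jump_succ]

/-- The topological order is built one vertex at a time: a minimal vertex outside `S` has all its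
predecessors in `S`. Registers of vertices outside `S` still contain F, as `CNode.runT_instrs`
requires. -/
theorem BoolCircuit.exists_closed_finset {Φ M : Type*} {n : ℕ} (C : BoolCircuit n) (k : ℕ)
    (hk : k ≤ C.size) :
    ∃ S : Finset (Fin C.size), S.card = k ∧ ∃ P : List (Instr Φ M), (∀ u ∈ P, u.IsBr) ∧
      P.length ≤ 4 * k ∧ ∀ b X, runT (extr (P ++ X)) (regEnv C.size b (fun _ => false) false) =
        runT (extr X) (regEnv C.size b
          (fun j => if h : j < C.size then decide (⟨j, h⟩ ∈ S) && C.val b ⟨j, h⟩ else false)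
          false) := by
  induction k with
  | zero => exact ⟨∅, rfl, [], by simp, by simp, fun b X => by simp⟩
  | succ k ih =>
    obtain ⟨S, hS, P, hP, hlen, hrun⟩ := ih (by omega)
    have hne : ({v | v ∉ S} : Set (Fin C.size)).Nonempty := by
      by_contra h
      rw [Set.not_nonempty_iff_eq_empty] at h
      have : S = Finset.univ := by
        ext v
        have := Set.eq_empty_iff_forall_notMem.1 h v
        simpa using this
      simp [this] at hS
      omega
    obtain ⟨v, hv, hmin⟩ := C.wellFounded.has_min _ hne
    have hv : v ∉ S := hv
    have hpred (u) (hu : (C.node v).HasPred u) : u ∈ S := by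
      by_contra h
      exact hmin u h hu
    refine ⟨insert v S, by simp [hv, hS], P ++ (C.node v).instrs Φ M v, ?_, ?_, ?_⟩
    · intro u hu
      rcases List.mem_append.1 hu with hu | hu
      · exact hP u hu
      · exact CNode.isBr_of_mem_instrs u hu
    · have := (C.node v).length_instrs_le (Φ := Φ) (M := M) v
      simp
      omega
    · intro b X
      rw [List.append_assoc, hrun,
        CNode.runT_instrs (v := v) _ (by simp [hv]) (fun u hu e => hv (e ▸ hpred u hu))]
      congr 2
      have hval : (C.node v).eval b (fun u _ => if h : (u : ℕ) < C.size then
          decide ((⟨u, h⟩ : Fin C.size) ∈ S) && C.val b ⟨u, h⟩ else false) = C.val b v := by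
        rw [C.val_eq]
        congr 1
        funext u hu
        simp [hpred u hu]
      rw [hval]
      funext j
      by_cases hj : j = v
      · subst hj
        simp
      · rw [Function.update_of_ne hj]
        by_cases h : j < C.size
        · have : (⟨j, h⟩ : Fin C.size) ≠ v := fun e => hj (by rw [← e])
          simp [h, this]
        · simp [h]

theorem BoolCircuit.exists_computes {Φ M : Type*} {n : ℕ} (C : BoolCircuit n) :
    ∃ X ∈ ISbr Φ M, Computes X C.output ∧ X.length ≤ 4 * C.size + 3 := by
  obtain ⟨S, hS, P, hP, hlen, hrun⟩ := C.exists_closed_finset (Φ := Φ) (M := M) C.size le_rfl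
  have hS : S = Finset.univ := (Finset.card_eq_iff_eq_univ S).1 (by simpa using hS)
  subst hS
  refine ⟨P ++ [.ptest ⟨.aux C.out, .get⟩, .plain ⟨.out, .set true⟩, .halt], ⟨by simp, ?_⟩,
    computes_iff.2 ⟨C.size, fun b => ?_⟩, by simpa using hlen⟩
  · intro u hu
    rcases List.mem_append.1 hu with hu | hu
    · exact hP u hu
    · simp only [List.mem_cons, List.not_mem_nil, or_false] at hu
      rcases hu with rfl | rfl | rfl <;> simp [Instr.IsBr, BasicInstr.IsBr]
  · rw [hrun, runT_ptest_get (c := C.val b C.out) (by simp [regEnv])]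
    rw [BoolCircuit.output]
    cases C.val b C.out
    · simp [extr, runT, regEnv]
    · simp only [if_true, runT_set_out]
      simp [extr, runT, regEnv]

/-- A nullary function is a constant. This covers the length for which P/poly provides no circuit.
-/
theorem exists_computes_zero {Φ M : Type*} (f : (Fin 0 → Bool) → Bool) :
    ∃ X ∈ ISbr Φ M, Computes X f ∧ X.length ≤ 2 := by
  refine ⟨[.plain ⟨.out, .set (f Fin.elim0)⟩, .halt], ⟨by simp, ?_⟩,
    computes_iff.2 ⟨0, fun b => ?_⟩, by simp⟩
  · simp [Instr.IsBr, BasicInstr.IsBr]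
  · rw [runT_set_out, Subsingleton.elim b Fin.elim0]
    simp [extr, runT, regEnv]

/-! ### Straight-line circuits -/

/-- The vertices `0, …, m - 1` with labels `node` form a circuit in topological order, possibly
with several sinks, in which the vertex `v` computes `g v`. -/
structure IsStraightLine {n : ℕ} (m : ℕ) (node : ℕ → CNode n ℕ)
    (g : ℕ → (Fin n → Bool) → Bool) : Prop where
  lt_of_hasPred : ∀ v < m, ∀ u, (node v).HasPred u → u < v
  eq_eval : ∀ v < m, ∀ b, g v b = (node v).eval b fun u _ => g u b
  existsUnique_input : ∀ i, ∃! v, v < m ∧ node v = .input i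

theorem CNode.eval_congr {n : ℕ} {V : Type} {b : Fin n → Bool} (c : CNode n V)
    {r r' : (u : V) → c.HasPred u → Bool} (h : ∀ u hu, r u hu = r' u hu) :
    c.eval b r = c.eval b r' := by
  congr 1
  funext u hu
  exact h u hu

/-- Labels defined on all of `ℕ` let a gate be appended by `Function.update` without recasting
indices. Excluding input labels keeps the input vertices unique. -/
theorem IsStraightLine.snoc {n m : ℕ} {node : ℕ → CNode n ℕ} {g : ℕ → (Fin n → Bool) → Bool}
    (H : IsStraightLine m node g) (c : CNode n ℕ) (hc : ∀ u, c.HasPred u → u < m)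
    (hin : ∀ i, c ≠ .input i) :
    IsStraightLine (m + 1) (Function.update node m c)
      (Function.update g m fun b => c.eval b fun u _ => g u b) where
  lt_of_hasPred v hv u hu := by
    by_cases h : v = m
    · subst h
      exact hc u (by simpa using hu)
    · rw [Function.update_of_ne h] at hu
      exact H.lt_of_hasPred v (by omega) u hu
  eq_eval v hv b := by
    by_cases h : v = m
    · subst h
      rw [Function.update_self, Function.update_self]
      refine CNode.eval_congr _ fun u hu => ?_
      rw [Function.update_of_ne (hc u hu).ne]
    · rw [Function.update_of_ne h, Function.update_of_ne h, H.eq_eval v (by omega)]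
      refine CNode.eval_congr _ fun u hu => ?_
      have := H.lt_of_hasPred v (by omega) u hu
      rw [Function.update_of_ne (by omega)]
  existsUnique_input i := by
    obtain ⟨v, ⟨hv, hvi⟩, huniq⟩ := H.existsUnique_input i
    refine ⟨v, ⟨by omega, by rwa [Function.update_of_ne hv.ne]⟩, fun w ⟨hw, hwi⟩ => ?_⟩
    by_cases h : w = m
    · subst h
      rw [Function.update_self] at hwi
      exact absurd hwi (hin i)
    · rw [Function.update_of_ne h] at hwi
      exact huniq w ⟨by omega, hwi⟩

/-- The same label, with the tails of the entering edges in `Fin m`. -/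
def CNode.toFin {n m : ℕ} : (c : CNode n ℕ) → (∀ u, c.HasPred u → u < m) → CNode n (Fin m)
  | .input i, _ => .input i
  | .not u, h => .not ⟨u, h u rfl⟩
  | .or u v, h => .or ⟨u, h u (Or.inl rfl)⟩ ⟨v, h v (Or.inr rfl)⟩
  | .and u v, h => .and ⟨u, h u (Or.inl rfl)⟩ ⟨v, h v (Or.inr rfl)⟩

theorem CNode.hasPred_toFin {n m : ℕ} (c : CNode n ℕ) (h : ∀ u, c.HasPred u → u < m)
    (u : Fin m) : (c.toFin h).HasPred u ↔ c.HasPred u := by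
  cases c <;> simp [CNode.toFin, CNode.HasPred, Fin.ext_iff]

theorem CNode.toFin_eq_input {n m : ℕ} (c : CNode n ℕ) (h : ∀ u, c.HasPred u → u < m)
    (i : Fin n) : c.toFin h = .input i ↔ c = .input i := by
  cases c <;> simp [CNode.toFin]

theorem CNode.eval_toFin {n m : ℕ} (c : CNode n ℕ) (h : ∀ u, c.HasPred u → u < m)
    (b : Fin n → Bool) (g : ℕ → Bool) :
    (c.toFin h).eval b (fun u _ => g u) = c.eval b fun u _ => g u := by
  cases c <;> rfl

theorem IsStraightLine.exists_circuit_of_sink {n m : ℕ} {node : ℕ → CNode n ℕ}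
    {g : ℕ → (Fin n → Bool) → Bool} (H : IsStraightLine m node g) {c : ℕ} (hc : c < m)
    (hsink : ∀ v < m, (∀ w < m, ¬ (node w).HasPred v) → v = c) :
    ∃ C : BoolCircuit n, C.size = m ∧ C.output = g c := by
  have hlt (v : Fin m) (u) (hu : (node v).HasPred u) : u < m :=
    (H.lt_of_hasPred v v.2 u hu).trans v.2
  -- Edges lead from smaller to larger numbers, so vertex `m - 1` is a sink and hence equals `c`.
  have hc' : ∀ w < m, ¬ (node w).HasPred c := by
    have hlast : ∀ w < m, ¬ (node w).HasPred (m - 1) := fun w hw h => by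
      have := H.lt_of_hasPred w hw _ h
      omega
    rwa [hsink (m - 1) (by omega) hlast] at hlast
  let C : BoolCircuit n :=
    { size := m
      node := fun v => (node v).toFin (hlt v)
      acyclic := by
        intro v hv
        have key : ∀ u w : Fin m, Relation.TransGen
            (fun u w : Fin m => ((node w).toFin (hlt w)).HasPred u) u w → u < w := by
          intro u w h
          induction h with
          | single h => exact H.lt_of_hasPred _ (Fin.is_lt _) _ ((CNode.hasPred_toFin _ _ _).1 h)
          | tail _ h ih =>
            exact ih.trans
              (H.lt_of_hasPred _ (Fin.is_lt _) _ ((CNode.hasPred_toFin _ _ _).1 h))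
        exact lt_irrefl _ (key v v hv)
      exists_unique_input := by
        intro i
        obtain ⟨v, ⟨hv, hvi⟩, huniq⟩ := H.existsUnique_input i
        refine ⟨⟨v, hv⟩, (CNode.toFin_eq_input _ _ _).2 hvi, fun w hw => Fin.ext ?_⟩
        exact huniq w ⟨w.2, (CNode.toFin_eq_input _ _ _).1 hw⟩
      out := ⟨c, hc⟩
      sink_iff := by
        intro v
        simp only [CNode.hasPred_toFin]
        constructor
        · intro h
          exact Fin.ext (hsink v v.2 fun w hw => h ⟨w, hw⟩)
        · rintro rfl w
          exact hc' w w.2 }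
  refine ⟨C, rfl, funext fun b => ?_⟩
  have key : ∀ v : Fin m, C.val b v = g v b := by
    intro v
    induction v using C.wellFounded.induction with
    | _ v ih =>
      rw [C.val_eq, H.eq_eval v v.2, ← CNode.eval_toFin _ (hlt v) b fun u => g u b]
      exact CNode.eval_congr _ ih
  exact key ⟨c, hc⟩

/-- Sinks other than `c` are eliminated by replacing `c` by `c ∨ (c ∧ v)`. -/
theorem IsStraightLine.exists_circuit_of_sinks {n m : ℕ} {node : ℕ → CNode n ℕ}
    {g : ℕ → (Fin n → Bool) → Bool} (H : IsStraightLine m node g) {c : ℕ} (hc : c < m)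
    (U : Finset ℕ) (hU : ∀ v ∈ U, v < m)
    (hsink : ∀ v < m, (∀ w < m, ¬ (node w).HasPred v) → v = c ∨ v ∈ U) :
    ∃ C : BoolCircuit n, C.size = m + 2 * U.card ∧ C.output = g c := by
  induction U using Finset.induction_on generalizing m node g c with
  | empty => simpa using H.exists_circuit_of_sink hc (by simpa using hsink)
  | insert x U hx ih =>
    have hxm : x < m := hU x (by simp)
    have H1 := H.snoc (.and c x) (by rintro u (rfl | rfl) <;> assumption) (by simp)
    have H2 := H1.snoc (.or c m) (by rintro u (rfl | rfl) <;> omega) (by simp)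
    -- Vertex `m + 1` takes over the role of `c`. Since `c`, `x` and `m` now have successors, the
    -- other sinks lie in `U`.
    obtain ⟨C, hC, hout⟩ := ih H2 (c := m + 1) (by omega)
      (fun v hv => by have := hU v (by simp [hv]); omega) (by
        intro v hv h
        have h1 := h (m + 1) (by omega)
        have h0 := h m (by omega)
        rw [Function.update_self] at h1
        rw [Function.update_of_ne (by omega), Function.update_self] at h0
        simp only [CNode.HasPred, not_or] at h0 h1
        by_cases hv' : v = m + 1
        · exact Or.inl hv'
        · rcases hsink v (by omega) (fun w hw hp => h w (by omega) (by
            rwa [Function.update_of_ne (by omega), Function.update_of_ne (by omega)])) with e | e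
          · exact absurd e h0.1
          · rcases Finset.mem_insert.1 e with e | e
            · exact absurd e h0.2
            · exact Or.inr e)
    refine ⟨C, by rw [hC, Finset.card_insert_of_notMem hx]; ring, ?_⟩
    rw [hout]
    funext b
    simp only [Function.update_self, CNode.eval, Function.update_of_ne hc.ne]
    cases g c b <;> simp

/-- Some straight-line circuit with `m` vertices computes all functions in `S`. -/
def Generates {n : ℕ} (m : ℕ) (S : Set ((Fin n → Bool) → Bool)) : Prop :=
  ∃ node g, IsStraightLine m node g ∧ ∀ f ∈ S, ∃ v < m, g v = f

/-! ### Sets of functions computed by one straight-line circuit -/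

namespace Generates

variable {n m : ℕ} {S : Set ((Fin n → Bool) → Bool)}

theorem mono {S' : Set ((Fin n → Bool) → Bool)} (H : Generates m S) (h : S' ⊆ S) :
    Generates m S' := by
  obtain ⟨node, g, hs, hg⟩ := H
  exact ⟨node, g, hs, fun f hf => hg f (h hf)⟩

theorem exists_circuit (H : Generates m S) {f : (Fin n → Bool) → Bool} (hf : f ∈ S) :
    ∃ C : BoolCircuit n, C.size = 3 * m ∧ C.output = f := by
  obtain ⟨node, g, hs, hg⟩ := H
  obtain ⟨v, hv, rfl⟩ := hg f hf
  -- Every vertex is absorbed, sink or not, at two gates each: `m + 2 * m` vertices.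
  obtain ⟨C, hC, hout⟩ := hs.exists_circuit_of_sinks hv (Finset.range m) (by simp)
    (fun w hw _ => Or.inr (by simpa using hw))
  exact ⟨C, by rw [hC, Finset.card_range]; ring, hout⟩

theorem projections (n : ℕ) :
    Generates n (Set.range fun (i : Fin n) (b : Fin n → Bool) => b i) := by
  refine ⟨fun v => if h : v < n then .input ⟨v, h⟩ else .not 0,
    fun v b => if h : v < n then b ⟨v, h⟩ else false, ⟨?_, ?_, ?_⟩, ?_⟩
  · intro v hv u hu
    simp [hv, CNode.HasPred] at hu
  · intro v hv b
    -- The type of the last argument of `eval` depends on the label, so the label is made a variable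
    -- before it is substituted.
    have key (c : CNode n ℕ) (hc : c = .input ⟨v, hv⟩) (r : ℕ → Bool) :
        b ⟨v, hv⟩ = c.eval b fun u _ => r u := by
      subst hc
      rfl
    simp only [hv, dite_true]
    exact key _ (dif_pos hv) _
  · intro i
    refine ⟨i, ⟨i.2, by simp⟩, fun w ⟨hw, h⟩ => ?_⟩
    simp only [hw, dite_true, CNode.input.injEq] at h
    rw [← h]
  · rintro _ ⟨i, rfl⟩
    exact ⟨i, i.2, by simp⟩

theorem snoc {node : ℕ → CNode n ℕ} {g : ℕ → (Fin n → Bool) → Bool}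
    (hs : IsStraightLine m node g) (hg : ∀ f ∈ S, ∃ v < m, g v = f) (c : CNode n ℕ)
    (hc : ∀ u, c.HasPred u → u < m) (hin : ∀ i, c ≠ .input i) :
    Generates (m + 1) (insert (fun b => c.eval b fun u _ => g u b) S) := by
  refine ⟨_, _, hs.snoc c hc hin, fun f hf => ?_⟩
  rcases hf with rfl | hf
  · exact ⟨m, by omega, by simp⟩
  · obtain ⟨v, hv, rfl⟩ := hg f hf
    exact ⟨v, by omega, by rw [Function.update_of_ne hv.ne]⟩

theorem not (H : Generates m S) {f : (Fin n → Bool) → Bool} (hf : f ∈ S) :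
    Generates (m + 1) (insert (fun b => !f b) S) := by
  obtain ⟨node, g, hs, hg⟩ := H
  obtain ⟨v, hv, rfl⟩ := hg f hf
  exact snoc hs hg (.not v) (by rintro u rfl; exact hv) (by simp)

theorem or (H : Generates m S) {f f' : (Fin n → Bool) → Bool} (hf : f ∈ S) (hf' : f' ∈ S) :
    Generates (m + 1) (insert (fun b => f b || f' b) S) := by
  obtain ⟨node, g, hs, hg⟩ := H
  obtain ⟨v, hv, rfl⟩ := hg f hf
  obtain ⟨w, hw, rfl⟩ := hg f' hf'
  exact snoc hs hg (.or v w) (by rintro u (rfl | rfl) <;> assumption) (by simp)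

theorem and (H : Generates m S) {f f' : (Fin n → Bool) → Bool} (hf : f ∈ S) (hf' : f' ∈ S) :
    Generates (m + 1) (insert (fun b => f b && f' b) S) := by
  obtain ⟨node, g, hs, hg⟩ := H
  obtain ⟨v, hv, rfl⟩ := hg f hf
  obtain ⟨w, hw, rfl⟩ := hg f' hf'
  exact snoc hs hg (.and v w) (by rintro u (rfl | rfl) <;> assumption) (by simp)

/-- Circuits have no constant vertices: T is `¬x ∨ x` for the first input `x`, and F is its
negation. This takes three gates and needs an input. -/
theorem constants (hn : 1 ≤ n) : Generates (n + 3)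
    ({fun _ => false, fun _ => true} ∪ Set.range fun (i : Fin n) (b : Fin n → Bool) => b i) := by
  have H0 := projections n
  have H1 := H0.not (Set.mem_range_self ⟨0, hn⟩)
  have H2 := H1.or (Set.mem_insert _ _) (Set.mem_insert_of_mem _ (Set.mem_range_self ⟨0, hn⟩))
  have H3 := H2.not (Set.mem_insert _ _)
  refine H3.mono ?_
  rintro f ((rfl | rfl) | hf)
  · exact Or.inl (funext fun b => by simp)
  · exact Or.inr (Or.inl (funext fun b => by simp))
  · exact Or.inr (Or.inr (Or.inr hf))

end Generates

/-! ### From instruction sequences to circuits -/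

/-- States of a pass over an instruction sequence that sees every instruction once: the number of
instructions still to be skipped (`none` after execution has ended) and the contents of the
registers. -/
abbrev PassState (Φ : Type*) : Type _ := Option ℕ × (Focus Φ → Bool)

/-- The reply to a basic instruction. -/
def BasicInstr.replyIn {Φ M : Type*} (a : BasicInstr Φ M) (R : Focus Φ → Bool) : Bool :=
  match a.meth with
  | .set c => c
  | .get => R a.focus
  -- An arbitrary value: Boolean registers block the other methods.
  | .other _ => false

open Classical in
/-- The contents of the registers after a basic instruction. -/
noncomputable def BasicInstr.write {Φ M : Type*} (a : BasicInstr Φ M) (R : Focus Φ → Bool) :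
    Focus Φ → Bool :=
  match a.meth with
  | .set c => Function.update R a.focus c
  | .get => R
  | .other _ => R

/-- The state after executing an instruction. -/
noncomputable def Instr.exec {Φ M : Type*} (R : Focus Φ → Bool) : Instr Φ M → PassState Φ
  | .plain a => (some 0, a.write R)
  | .ptest a => (if a.replyIn R then some 0 else some 1, a.write R)
  | .ntest a => (if a.replyIn R then some 1 else some 0, a.write R)
  | .jump 0 => (none, R)
  | .jump (l + 1) => (some l, R)
  | .halt => (none, R)

/-- The state after passing an instruction. -/
noncomputable def Instr.pass {Φ M : Type*} (u : Instr Φ M) : PassState Φ → PassState Φ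
  | (none, R) => (none, R)
  | (some 0, R) => u.exec R
  | (some (j + 1), R) => (some j, R)

/-- The state after passing an instruction sequence. -/
noncomputable def passAll {Φ M : Type*} (X : List (Instr Φ M)) (s : PassState Φ) : PassState Φ :=
  X.foldl (fun s u => u.pass s) s

theorem passAll_none {Φ M : Type*} (X : List (Instr Φ M)) (R : Focus Φ → Bool) :
    passAll X (none, R) = (none, R) := by
  induction X with
  | nil => rfl
  | cons u X ih => exact ih

/-- Every provided service is a Boolean register with contents as in `R`. -/
def Agrees {Φ : Type*} (ρ : Focus Φ → Service) (R : Focus Φ → Bool) : Prop :=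
  ∀ x, ρ x = .br (R x) ∨ ρ x = .empty

open Classical in
theorem Agrees.basic {Φ M : Type*} {ρ : Focus Φ → Service} {R : Focus Φ → Bool}
    (h : Agrees ρ R) (a : BasicInstr Φ M) {c : Bool} (hc : (ρ a.focus).reply a.meth = .val c) :
    a.replyIn R = c ∧
      Agrees (Function.update ρ a.focus ((ρ a.focus).derive a.meth)) (a.write R) := by
  obtain ⟨x, m⟩ := a
  rcases h x with hx | hx
  · simp only [hx] at hc ⊢
    cases m with
    | set d =>
      simp only [Service.reply, Reply.val.injEq] at hc
      subst hc
      refine ⟨rfl, fun y => ?_⟩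
      by_cases hy : y = x
      · subst hy
        simp [BasicInstr.write, Service.derive]
      · simpa [BasicInstr.write, hy] using h y
    | get =>
      simp only [Service.reply, Reply.val.injEq] at hc
      refine ⟨hc, fun y => ?_⟩
      by_cases hy : y = x
      · subst hy
        simp [BasicInstr.write, Service.derive]
      · simpa [BasicInstr.write, hy] using h y
    | other m => simp [Service.reply] at hc
  · simp [hx, Service.reply] at hc

open Classical in
theorem runT_pcc_eq_br {Φ M : Type*} {ρ : Focus Φ → Service} {R : Focus Φ → Bool}
    (h : Agrees ρ R) {a : BasicInstr Φ M} {p q : Thread Φ M} {r : Bool}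
    (hr : runT (.pcc p a q) ρ = .br r) :
    ∃ ρ', Agrees ρ' (a.write R) ∧ runT (if a.replyIn R then p else q) ρ' = .br r := by
  rw [runT] at hr
  cases hc : (ρ a.focus).reply a.meth with
  | blocked => simp [hc] at hr
  | val c =>
    obtain ⟨h1, h2⟩ := h.basic a hc
    refine ⟨_, h2, ?_⟩
    cases c <;> simpa [hc, h1] using hr

/-- Dropping `j` instructions corresponds to skip count `j`. The pass does not notice blocking or a
missing next instruction, but a run that yields a value meets neither. After `!` the state is
frozen, so `out` survives to the end. -/
theorem passAll_out {Φ M : Type*} (X : List (Instr Φ M)) (j : ℕ) {ρ : Focus Φ → Service}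
    {R : Focus Φ → Bool} (h : Agrees ρ R) {r : Bool} (hr : runT (extr (X.drop j)) ρ = .br r) :
    (passAll X (some j, R)).2 .out = r := by
  induction X generalizing j ρ R with
  | nil => simp [extr, runT] at hr
  | cons u X ih =>
    cases j with
    | succ j => exact ih j h hr
    | zero =>
      change (passAll X (u.exec R)).2 .out = r
      rw [List.drop_zero] at hr
      cases u with
      | plain a =>
        rw [extr] at hr
        obtain ⟨ρ', h', hr'⟩ := runT_pcc_eq_br h hr
        exact ih 0 h' (by simpa using hr')
      | ptest a =>
        rw [extr, extr_jump_succ] at hr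
        obtain ⟨ρ', h', hr'⟩ := runT_pcc_eq_br h hr
        cases hc : a.replyIn R
        · simpa [Instr.exec, hc] using ih 1 h' (by simpa [hc] using hr')
        · simpa [Instr.exec, hc] using ih 0 h' (by simpa [hc] using hr')
      | ntest a =>
        rw [extr, extr_jump_succ] at hr
        obtain ⟨ρ', h', hr'⟩ := runT_pcc_eq_br h hr
        cases hc : a.replyIn R
        · simpa [Instr.exec, hc] using ih 0 h' (by simpa [hc] using hr')
        · simpa [Instr.exec, hc] using ih 1 h' (by simpa [hc] using hr')
      | jump l =>
        cases l with
        | zero => simp [extr, runT] at hr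
        | succ l =>
          rw [extr_jump_succ] at hr
          exact ih l h hr
      | halt =>
        simp only [extr, runT] at hr
        simp only [Instr.exec, passAll_none]
        rcases h .out with h | h <;> simp_all

/-- The signals that a circuit keeps for a state that depends on the input. -/
def signals {Φ : Type*} {n : ℕ} (s : (Fin n → Bool) → PassState Φ) :
    Set ((Fin n → Bool) → Bool) :=
  {fun _ => false, fun _ => true} ∪ (Set.range (fun q b => decide ((s b).1 = some q)) ∪
    Set.range fun x b => (s b).2 x)

/-! ### Gates needed to pass one instruction -/

section Signals

variable {Φ M : Type*} {n m : ℕ} {s : (Fin n → Bool) → PassState Φ}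

theorem const_mem_signals (c : Bool) : (fun _ => c) ∈ signals s := by
  cases c <;> simp [signals]

theorem skip_mem_signals (q : ℕ) : (fun b => decide ((s b).1 = some q)) ∈ signals s :=
  Or.inr (Or.inl ⟨q, rfl⟩)

theorem reg_mem_signals (x : Focus Φ) : (fun b => (s b).2 x) ∈ signals s :=
  Or.inr (Or.inr ⟨x, rfl⟩)

theorem replyIn_mem_signals (a : BasicInstr Φ M) :
    (fun b => a.replyIn (s b).2) ∈ signals s := by
  obtain ⟨x, m⟩ := a
  cases m with
  | set c => exact const_mem_signals c
  | get => exact reg_mem_signals x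
  | other m => exact const_mem_signals false

/-- The signals for the current and the next two instructions after a basic instruction. -/
theorem Generates.basic (H : Generates m (signals s)) (a : BasicInstr Φ M) :
    ∃ S, Generates (m + 11) S ∧ signals s ⊆ S ∧
      (fun b => decide ((s b).1 = some 1) || decide ((s b).1 = some 0)) ∈ S ∧
      (∀ q, q = 1 ∨ q = 2 →
        (fun b => decide ((s b).1 = some q) ||
          (decide ((s b).1 = some 0) && a.replyIn (s b).2)) ∈ S ∧
        (fun b => decide ((s b).1 = some q) ||
          (decide ((s b).1 = some 0) && !a.replyIn (s b).2)) ∈ S) ∧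
      ∀ x, (fun b => if (s b).1 = some 0 then a.write (s b).2 x else (s b).2 x) ∈ S := by
  classical
  have mem {f} {T : Set ((Fin n → Bool) → Bool)} (g) (h : f ∈ T) : f ∈ insert g T :=
    Set.mem_insert_of_mem g h
  have A := skip_mem_signals (s := s)
  have t := replyIn_mem_signals (s := s) a
  have r := reg_mem_signals (s := s) a.focus
  have H1 := ((H.not t).not (mem _ (A 0))).or (mem _ <| mem _ <| A 1) (mem _ <| mem _ <| A 0)
  have H2 := H1.and (mem _ <| mem _ <| mem _ <| A 0) (mem _ <| mem _ <| mem _ t)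
  have H3 := H2.and (mem _ <| mem _ <| mem _ <| mem _ <| A 0)
    (mem _ <| mem _ <| mem _ <| Set.mem_insert _ _)
  have e (q) := mem (fun b => decide ((s b).1 = some 0) && !a.replyIn (s b).2) <|
    mem (fun b => decide ((s b).1 = some 0) && a.replyIn (s b).2) <|
    mem (fun b => decide ((s b).1 = some 1) || decide ((s b).1 = some 0)) <|
    mem (fun b => !decide ((s b).1 = some 0)) <| mem (fun b => !a.replyIn (s b).2) <| A q
  -- After a test, skip count 0 comes from count 1, or from count 0 with one reply; skip count 1
  -- comes from count 2, or from count 0 with the opposite reply. Four gates cover both kinds of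
  -- test.
  have H4 := H3.or (e 1) (Set.mem_insert _ _)
  have H5 := H4.or (mem _ <| e 1) (mem _ <| mem _ <| Set.mem_insert _ _)
  have H6 := H5.or (mem _ <| mem _ <| e 2) (mem _ <| mem _ <| Set.mem_insert _ _)
  have H7 := H6.or (mem _ <| mem _ <| mem _ <| e 2)
    (mem _ <| mem _ <| mem _ <| mem _ <| Set.mem_insert _ _)
  -- With `z` for "the instruction is executed" and `r` for the addressed register, `set:T` gives `z
  -- ∨ r` and `set:F` gives `r ∧ ¬z`. Both gates are built whatever the method is.
  have H8 := H7.or (mem _ <| mem _ <| mem _ <| mem _ <| e 0)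
    (by iterate 9 apply mem
        exact r)
  have H9 := H8.and (by iterate 10 apply mem
                        exact r)
    (by iterate 8 apply mem
        exact Set.mem_insert _ _)
  refine ⟨_, H9, ?_, ?_, ?_, ?_⟩
  · intro f hf
    iterate 11 apply mem
    exact hf
  · iterate 8 apply mem
    exact Set.mem_insert _ _
  · rintro q (rfl | rfl)
    · refine ⟨?_, ?_⟩
      · iterate 4 apply mem
        exact Set.mem_insert _ _
      · iterate 5 apply mem
        exact Set.mem_insert _ _
    · refine ⟨?_, ?_⟩
      · iterate 2 apply mem
        exact Set.mem_insert _ _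
      · iterate 3 apply mem
        exact Set.mem_insert _ _
  · intro x
    have old : (fun b => (s b).2 x) ∈ signals s := reg_mem_signals x
    obtain ⟨y, μ⟩ := a
    by_cases hμ : (∃ c, μ = .set c) ∧ x = y
    · obtain ⟨⟨c, rfl⟩, rfl⟩ := hμ
      cases c with
      | true =>
        right; left
        funext b
        by_cases h : (s b).1 = some 0 <;> simp [h, BasicInstr.write]
      | false =>
        left
        funext b
        by_cases h : (s b).1 = some 0 <;> simp [h, BasicInstr.write]
    · have : (fun b => if (s b).1 = some 0 then BasicInstr.write ⟨y, μ⟩ (s b).2 x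
          else (s b).2 x) = fun b => (s b).2 x := by
        funext b
        cases μ with
        | set c =>
          have hx : x ≠ y := fun e => hμ ⟨⟨c, rfl⟩, e⟩
          simp [BasicInstr.write, hx]
        | _ => simp [BasicInstr.write]
      rw [this]
      iterate 11 apply mem
      exact old

/-- Padding consists of superfluous negations of some member of `S`. -/
theorem Generates.weaken {S : Set ((Fin n → Bool) → Bool)} (H : Generates m S) (hS : S.Nonempty)
    {m' : ℕ} (h : m ≤ m') : Generates m' S := by
  induction h with
  | refl => exact H
  | step _ ih => exact (ih.not hS.some_mem).mono (Set.subset_insert _ _)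

theorem fst_pass (u : Instr Φ M) (t : PassState Φ) (q : ℕ) :
    decide ((u.pass t).1 = some q) = (decide (t.1 = some (q + 1)) ||
      (decide (t.1 = some 0) && decide ((u.exec t.2).1 = some q))) := by
  rw [Bool.eq_iff_iff]
  obtain ⟨_ | _ | j, R⟩ := t
  · simp [Instr.pass]
  · simp only [Bool.or_eq_true, Bool.and_eq_true, decide_eq_true_iff]
    simp [Instr.pass]
  · simp [Instr.pass]

theorem snd_pass (u : Instr Φ M) (t : PassState Φ) (x : Focus Φ) :
    (u.pass t).2 x = if t.1 = some 0 then (u.exec t.2).2 x else t.2 x := by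
  obtain ⟨_ | _ | j, R⟩ := t <;> simp [Instr.pass]

theorem signals_subset {t : (Fin n → Bool) → PassState Φ} {S : Set ((Fin n → Bool) → Bool)}
    (h : signals s ⊆ S) (hskip : ∀ q, (fun b => decide ((t b).1 = some q)) ∈ S)
    (hreg : ∀ x, (fun b => (t b).2 x) ∈ S) : signals t ⊆ S := by
  rintro f ((rfl | rfl) | ⟨q, rfl⟩ | ⟨x, rfl⟩)
  · exact h (const_mem_signals false)
  · exact h (const_mem_signals true)
  · exact hskip q
  · exact hreg x

/-- By `fst_pass`, the new indicator of `q` is the old one of `q + 1`, already available, unless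
executing `u` can lead to skip count `q`. At most two values of `q` are of that kind, and at most
one register changes. -/
theorem Generates.pass (H : Generates m (signals s)) (u : Instr Φ M) :
    Generates (m + 11) (signals fun b => u.pass (s b)) := by
  have hne : (signals s).Nonempty := ⟨_, const_mem_signals true⟩
  -- Instructions that end the execution lead to no skip count and change no register, so no gate is
  -- needed.
  have ended (hu : ∀ R, u.exec R = (none, R)) :
      Generates (m + 11) (signals fun b => u.pass (s b)) := by
    refine (H.weaken hne (by omega)).mono (signals_subset subset_rfl (fun q => ?_) fun x => ?_)
    · simpa [fst_pass, hu] using skip_mem_signals (s := s) (q + 1)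
    · simpa [snd_pass, hu] using reg_mem_signals (s := s) x
  cases u with
  | plain a =>
    obtain ⟨S, hS, hsub, h1, -, hw⟩ := H.basic a
    refine hS.mono (signals_subset hsub (fun q => ?_) fun x => ?_)
    · simp only [fst_pass, Instr.exec]
      rcases q with _ | q
      · simpa using h1
      · simpa using hsub (skip_mem_signals (s := s) (q + 2))
    · simpa only [snd_pass, Instr.exec] using hw x
  | ptest a =>
    obtain ⟨S, hS, hsub, -, h1, hw⟩ := H.basic a
    refine hS.mono (signals_subset hsub (fun q => ?_) fun x => ?_)
    · simp only [fst_pass, Instr.exec]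
      rcases q with _ | _ | q
      · convert (h1 1 (by simp)).1 using 4 with b
        by_cases h : a.replyIn (s b).2 = true <;> simp [h]
      · convert (h1 2 (by simp)).2 using 4 with b
        by_cases h : a.replyIn (s b).2 = true <;> simp [h]
      · convert hsub (skip_mem_signals (s := s) (q + 3)) using 2 with b
        by_cases h : a.replyIn (s b).2 = true <;> simp [h]
    · simpa only [snd_pass, Instr.exec] using hw x
  | ntest a =>
    obtain ⟨S, hS, hsub, -, h1, hw⟩ := H.basic a
    refine hS.mono (signals_subset hsub (fun q => ?_) fun x => ?_)
    · simp only [fst_pass, Instr.exec]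
      rcases q with _ | _ | q
      · convert (h1 1 (by simp)).2 using 4 with b
        by_cases h : a.replyIn (s b).2 = true <;> simp [h]
      · convert (h1 2 (by simp)).1 using 4 with b
        by_cases h : a.replyIn (s b).2 = true <;> simp [h]
      · convert hsub (skip_mem_signals (s := s) (q + 3)) using 2 with b
        by_cases h : a.replyIn (s b).2 = true <;> simp [h]
    · simpa only [snd_pass, Instr.exec] using hw x
  | jump l =>
    cases l with
    | zero => exact ended fun R => rfl
    | succ l =>
      have H' := H.or (skip_mem_signals (l + 1)) (skip_mem_signals 0)
      refine (H'.weaken ⟨_, Set.mem_insert _ _⟩ (by omega)).mono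
        (signals_subset (Set.subset_insert _ _) (fun q => ?_) fun x => ?_)
      · simp only [fst_pass, Instr.exec]
        by_cases hq : l = q
        · subst hq
          left
          simp
        · right
          simpa [hq] using skip_mem_signals (s := s) (q + 1)
      · right
        simpa [snd_pass, Instr.exec] using reg_mem_signals (s := s) x
  | halt => exact ended fun R => rfl

theorem Generates.passAll (H : Generates m (signals s)) (X : List (Instr Φ M)) :
    Generates (m + 11 * X.length) (signals fun b => passAll X (s b)) := by
  induction X generalizing m s with
  | nil => exact H
  | cons u X ih =>
    have := ih (H.pass u)
    rw [List.length_cons, mul_add, mul_one, add_comm (11 * X.length), ← add_assoc]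
    exact this

end Signals

/-- The initial contents of the registers. -/
def initRegs (Φ : Type*) {n : ℕ} (b : Fin n → Bool) : Focus Φ → Bool
  | .inp i => if h : i < n then b ⟨i, h⟩ else false
  | _ => false

/-- Registers that are not provided count as containing F, so the number `l` of auxiliary registers
does not enter the circuit size. -/
theorem agrees_regEnv {Φ : Type*} {n : ℕ} (l : ℕ) (b : Fin n → Bool) :
    Agrees (regEnv l b (fun _ => false) false) (initRegs Φ b) := by
  intro x
  cases x with
  | inp i => by_cases h : i < n <;> simp [regEnv, initRegs, h]
  | aux j => by_cases h : j < l <;> simp [regEnv, initRegs, h]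
  | out => simp [regEnv, initRegs]
  | other y => simp [regEnv]

theorem generates_init (Φ : Type*) {n : ℕ} (hn : 1 ≤ n) :
    Generates (n + 3) (signals fun b : Fin n → Bool => (some 0, initRegs Φ b)) := by
  refine (Generates.constants hn).mono ?_
  rintro f ((rfl | rfl) | ⟨q, rfl⟩ | ⟨x, rfl⟩)
  · simp
  · simp
  · by_cases hq : 0 = q <;> simp [hq]
  · cases x with
    | inp i =>
      by_cases h : i < n
      · exact Or.inr ⟨⟨i, h⟩, by simp [initRegs, h]⟩
      · simp [initRegs, h]
    | _ => simp [initRegs]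

theorem Computes.exists_circuit {Φ M : Type*} {n : ℕ} (hn : 1 ≤ n) {X : List (Instr Φ M)}
    {f : (Fin n → Bool) → Bool} (hX : Computes X f) :
    ∃ C : BoolCircuit n, C.size = 3 * (n + 3 + 11 * X.length) ∧ C.output = f := by
  obtain ⟨l, hl⟩ := computes_iff.1 hX
  have H := (generates_init Φ hn).passAll X
  obtain ⟨C, hC, hout⟩ := H.exists_circuit (reg_mem_signals .out)
  exact ⟨C, hC, hout.trans (funext fun b => passAll_out X 0 (agrees_regEnv l b) (hl b))⟩

end SinglePass

open SinglePass in
theorem mainTheorem1 (Φ M : Type*) :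
    SinglePass.familyEquiv '' SinglePass.PLIS Φ M = SinglePass.PPoly := by
  ext g
  constructor
  · rintro ⟨f, ⟨h, ⟨p, hp⟩, hf⟩, rfl⟩
    refine ⟨fun n => 3 * (n + 3 + 11 * h n),
      ⟨3 * (Polynomial.X + 3 + 11 * p), fun n => by simp [hp]⟩, fun n hn => ?_⟩
    obtain ⟨X, -, hX, hlen⟩ := hf n
    obtain ⟨C, hC, hout⟩ := hX.exists_circuit hn
    refine ⟨C, by rw [hC]; dsimp only; gcongr, fun b => ?_⟩
    rw [hout]
    exact (congrFun (congrFun (familyEquiv.left_inv f) n) b).symm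
  · rintro ⟨T, ⟨p, hp⟩, hT⟩
    refine ⟨familyEquiv.symm g, ⟨fun n => 4 * T n + 3, ⟨4 * p + 3, fun n => by simp [hp]⟩,
      fun n => ?_⟩, familyEquiv.apply_symm_apply g⟩
    rcases Nat.eq_zero_or_pos n with rfl | hn
    · obtain ⟨X, hX, hc, hlen⟩ := exists_computes_zero (Φ := Φ) (M := M) (familyEquiv.symm g 0)
      exact ⟨X, hX, hc, by dsimp only; omega⟩
    · obtain ⟨C, hC, hout⟩ := hT n hn
      obtain ⟨X, hX, hc, hlen⟩ := C.exists_computes (Φ := Φ) (M := M)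
      have : C.output = familyEquiv.symm g n := funext hout
      exact ⟨X, hX, this ▸ hc, by dsimp only; omega⟩
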